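/- For Hermitian $n\times n$ complex matrices $X$ and $Y$, let $\lambda_1^\downarrow(X)\ge\dots\ge\lambda_n^\downarrow(X)$ denote the eigenvalues of $X$, counted with multiplicity, in non-increasing order, and let $\delta(Y;X)=(\delta_1(Y;X),\dots,\delta_n(Y;X))\in\mathbb{R}^n$ be the vector determined by $$\sum_{j=1}^k \delta_j(Y;X) = \frac{d}{dt}\Big|_{t=0^+}\ \sum_{j=1}^k \lambda_j^\downarrow(X+tY),\qquad 1\le k\le n .$$ For $a,b\in\mathbb{R}^n$ write $a\prec_w b$ if $\sum_{j=1}^k a_j\le\sum_{j=1}^k b_j$ for all $1\le k\le n$ (without rearranging the entries). Let $A$ and $B$ be positive semidefinite $n\times n$ complex matrices, and let $f:[0,\infty)\to[0,\infty)$ be a concave function with $f(0)=0$. Then the one-sided derivatives that define $\delta(f(A+B);A+B)$ and $\delta(f(A)+f(B);A+B)$ exist, and $$\delta\big(f(A+B);A+B\big)\ \prec_w\ \delta\big(f(A)+f(B);A+B\big),$$ where $f(X)$ is defined by the spectral functional calculus. -/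

import Mathlib

open scoped ComplexOrder

namespace DominatedMajorization

noncomputable section

/-- For Hermitian `A`, `B` and real `t`, the matrix `A + t B` is Hermitian. -/
lemma isHermitian_add_smul {n : ℕ} {A B : Matrix (Fin n) (Fin n) ℂ}
    (hB : B.IsHermitian) (hA : A.IsHermitian) (t : ℝ) : (A + t • B).IsHermitian :=
  hA.add (IsSelfAdjoint.smul (IsSelfAdjoint.all t) hB)

/-- `f(A)` (functional calculus) is Hermitian. -/
lemma isHermitian_cfc {n : ℕ} (f : ℝ → ℝ) (A : Matrix (Fin n) (Fin n) ℂ) :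
    (cfc f A).IsHermitian :=
  cfc_predicate (R := ℝ) (p := IsSelfAdjoint) f A

/-- The vector of eigenvalues of a Hermitian matrix, with multiplicity, in non-increasing order. -/
def eigs {n : ℕ} {A : Matrix (Fin n) (Fin n) ℂ} (hA : A.IsHermitian) (j : Fin n) : ℝ :=
  hA.eigenvalues₀ (Fin.cast (Fintype.card_fin n).symm j)

lemma eigs_antitone {n : ℕ} {A : Matrix (Fin n) (Fin n) ℂ} (hA : A.IsHermitian) :
    Antitone (eigs hA) :=
  fun _ _ h => hA.eigenvalues₀_antitone h

/-- The sum of the first `k` entries of a vector. -/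
def partialSum {n : ℕ} (a : Fin n → ℝ) (k : ℕ) : ℝ :=
  ∑ j : Fin n with j.val < k, a j

/-- `t ↦ ∑_{j ≤ k} λ_j↓(A + t B)`, the sum of the `k` largest eigenvalues along a line. -/
def kyFanPath {n : ℕ} {A B : Matrix (Fin n) (Fin n) ℂ}
    (hB : B.IsHermitian) (hA : A.IsHermitian) (k : ℕ) (t : ℝ) : ℝ :=
  partialSum (eigs (isHermitian_add_smul hB hA t)) k

/-- The directional (right) derivative at `t = 0⁺` of the sum of the `k` largest eigenvalues
of `A + t B`. -/
def kyFanDeriv {n : ℕ} {A B : Matrix (Fin n) (Fin n) ℂ}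
    (hB : B.IsHermitian) (hA : A.IsHermitian) (k : ℕ) : ℝ :=
  derivWithin (kyFanPath hB hA k) (Set.Ici 0) 0

/-- The vector `δ(B; A)`: the vector whose partial sums are the directional derivatives of the
sums of the largest eigenvalues of `A` in the direction `B`; see `partialSum_delta`. -/
def delta {n : ℕ} {A B : Matrix (Fin n) (Fin n) ℂ}
    (hB : B.IsHermitian) (hA : A.IsHermitian) (j : Fin n) : ℝ :=
  kyFanDeriv hB hA (j.val + 1) - kyFanDeriv hB hA j.val

/-- The defining equation of `δ(B; A)`. -/
theorem partialSum_delta {n : ℕ} {A B : Matrix (Fin n) (Fin n) ℂ}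
    (hB : B.IsHermitian) (hA : A.IsHermitian) (k : ℕ) (hk : k ≤ n) :
    partialSum (delta hB hA) k = kyFanDeriv hB hA k := by
  induction k with
  | zero =>
    have h : kyFanPath hB hA 0 = fun _ => (0 : ℝ) := by
      funext t
      simp [kyFanPath, partialSum]
    simp [kyFanDeriv, h, partialSum]
  | succ k ih =>
    have hset : (Finset.univ.filter fun j : Fin n => j.val < k + 1)
        = insert (⟨k, hk⟩ : Fin n) (Finset.univ.filter fun j : Fin n => j.val < k) := by
      ext j
      simp only [Finset.mem_filter, Finset.mem_univ, true_and, Finset.mem_insert, Fin.ext_iff]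
      omega
    have ih' := ih (by omega)
    unfold partialSum at ih' ⊢
    rw [hset, Finset.sum_insert (by simp), ih']
    simp [delta]

/-- The relation `a ≺_w b`: each partial sum of `a` is at most that of `b`.
The entries of the vectors are not rearranged. -/
def WeakMajorized {n : ℕ} (a b : Fin n → ℝ) : Prop :=
  ∀ k : ℕ, 1 ≤ k → k ≤ n → partialSum a k ≤ partialSum b k

end

end DominatedMajorization

namespace DominatedMajorization

open scoped InnerProductSpace

/-! ### Rearrangement inequalities for real vectors. -/

section Scalar

/-! Put `S = A + B` with eigenvalues `s_i` and eigenvectors `u_i`. Since `f` is nondecreasing, `S +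
t f(S)` keeps the eigenvalue order of `S`, so its Ky Fan sum is at most `∑ (s_i + t f(s_i))`
(`kyFanPath_cfc_le`). Testing `S + t(f(A) + f(B))` on the `u_i` bounds its Ky Fan sum from below
(`le_kyFanPath`). Both paths agree at `t = 0`, so it remains to show `∑_{i ≤ k} f(s_i) ≤ ∑_{i ≤ k}
⟨u_i, (f(A) + f(B)) u_i⟩` (`partialSum_apply_le`).

Writing `f(s_i) = (f(s_i)/s_i) ⟨u_i, (A + B) u_i⟩` separates `A` from `B`; each half is
`sum_div_mul_diagForm_le`, which needs only `0 ≤ A ≤ S`. There, with `l = s_k > 0`, the operator `W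
= l + √A (1 - l/S)₊ √A` dominates both `A` and `l`. Weyl monotonicity and a trace inequality for the
decreasing function `f(t)/t`, truncated at `l`, bound `tr f(W)` above by a compression of `f(A)`
plus a multiple of `f(l)`; Jensen in an eigenbasis of `W` bounds `tr f(W)` below. The `f(l)` terms
cancel. -/

lemma partialSum_self {n : ℕ} (a : Fin n → ℝ) : partialSum a n = ∑ j, a j := by
  simp [partialSum]

lemma partialSum_castSucc {n : ℕ} (z : Fin (n + 1) → ℝ) {k : ℕ} (hk : k ≤ n) :
    partialSum (fun j : Fin n => z j.castSucc) k = partialSum z k := by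
  unfold partialSum
  rw [Finset.sum_filter, Finset.sum_filter, Fin.sum_univ_castSucc]
  simp [hk]

/-- Abel summation: a vector with nonnegative partial sums, paired with a monotone vector. -/
lemma sum_mul_le_of_monotone {n : ℕ} {c z : Fin n → ℝ} (hc : Monotone c)
    (hz : ∀ k ≤ n, 0 ≤ partialSum z k) {M : ℝ} (hM : ∀ j, c j ≤ M) :
    ∑ j, c j * z j ≤ M * ∑ j, z j := by
  induction n generalizing M with
  | zero => simp
  | succ n ih =>
    have h1 := ih (c := fun j => c j.castSucc) (z := fun j => z j.castSucc)
      (fun i j h => hc (Fin.castSucc_le_castSucc_iff.2 h))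
      (fun k hk => by rw [partialSum_castSucc z hk]; exact hz k (by omega))
      (M := c (Fin.last n)) (fun j => hc (Fin.le_last _))
    have h2 := hz (n + 1) le_rfl
    rw [partialSum_self] at h2
    rw [Fin.sum_univ_castSucc]
    have h3 := mul_le_mul_of_nonneg_right (hM (Fin.last n)) h2
    rw [Fin.sum_univ_castSucc] at h3 ⊢
    linarith [mul_add (c (Fin.last n)) (∑ j : Fin n, z j.castSucc) (z (Fin.last n))]

/-- Abel summation applied to `w - y`: its total is zero, so the choice of the bound `M` is
immaterial. -/
lemma sum_mul_le_sum_mul_of_monotone {n : ℕ} {c y w : Fin n → ℝ} (hc : Monotone c)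
    (h : ∀ k ≤ n, partialSum y k ≤ partialSum w k) (htot : ∑ j, y j = ∑ j, w j) :
    ∑ j, c j * w j ≤ ∑ j, c j * y j := by
  have hM : ∃ M, ∀ j, c j ≤ M := by
    obtain ⟨M, hM⟩ := (Set.finite_range c).bddAbove
    exact ⟨M, fun j => hM ⟨j, rfl⟩⟩
  obtain ⟨M, hM⟩ := hM
  have := sum_mul_le_of_monotone (z := fun j => w j - y j) hc
    (fun k hk => by
      have := h k hk
      simp only [partialSum, Finset.sum_sub_distrib] at this ⊢
      linarith) hM
  simp only [mul_sub, Finset.sum_sub_distrib, htot, sub_self] at this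
  linarith

/-- Among the weight vectors with entries in `[0, 1]` and total weight `k`, the indicator of the
first `k` indices maximizes the pairing with an antitone vector. -/
lemma sum_mul_le_partialSum {n k : ℕ} (hk : k ≤ n) {c q : Fin n → ℝ} (hc : Antitone c)
    (hq0 : ∀ i, 0 ≤ q i) (hq1 : ∀ i, q i ≤ 1) (hq : ∑ i, q i = k) :
    ∑ i, c i * q i ≤ partialSum c k := by
  rcases Nat.eq_zero_or_pos k with rfl | hpos
  · have : ∀ i, q i = 0 := fun i =>
      (Finset.sum_eq_zero_iff_of_nonneg fun i _ => hq0 i).1 (by simpa using hq) i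
        (Finset.mem_univ _)
    simp [this, partialSum]
  -- Both weights have total `k`, so shifting `c` by its last selected value `c m` changes nothing
  -- and makes every term of the difference nonnegative.
  · set m : Fin n := ⟨k - 1, by omega⟩
    have hcard : ∑ i : Fin n, (if i.val < k then (1 : ℝ) else 0) = k := by
      rw [← Finset.sum_filter, Finset.sum_const, nsmul_eq_mul, mul_one,
        Fin.card_filter_val_lt, min_eq_right hk]
    have hterm : ∀ i, 0 ≤ (c i - c m) * ((if i.val < k then (1 : ℝ) else 0) - q i) := by
      intro i
      split_ifs with h
      · exact mul_nonneg (sub_nonneg.2 (hc (Fin.le_def.2 (by simp [m]; omega))))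
          (sub_nonneg.2 (hq1 i))
      · exact mul_nonneg_of_nonpos_of_nonpos
          (sub_nonpos.2 (hc (Fin.le_def.2 (by simp [m]; omega)))) (by linarith [hq0 i])
    have hsum := Finset.sum_nonneg fun i (_ : i ∈ Finset.univ) => hterm i
    have hexp : ∀ i, (c i - c m) * ((if i.val < k then (1 : ℝ) else 0) - q i)
        = (if i.val < k then c i else 0) - c i * q i
          - c m * ((if i.val < k then (1 : ℝ) else 0) - q i) := by
      intro i; split_ifs <;> ring
    simp only [hexp, Finset.sum_sub_distrib, ← Finset.mul_sum, hcard, hq] at hsum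
    rw [partialSum, Finset.sum_filter]
    linarith

end Scalar

/-! ### Quadratic forms diagonal in an orthonormal basis: Ky Fan, Weyl, von Neumann. -/

section Form

variable {E : Type*} [NormedAddCommGroup E] [InnerProductSpace ℂ E] {n : ℕ}

/-- The quadratic form that is diagonal with entries `s` in the orthonormal basis `u`. -/
noncomputable def diagForm (u : OrthonormalBasis (Fin n) ℂ E) (s : Fin n → ℝ) (x : E) : ℝ :=
  ∑ i, s i * ‖⟪u i, x⟫_ℂ‖ ^ 2

/-- The operator that is diagonal with entries `s` in the orthonormal basis `u`. -/
noncomputable def diagOp (u : OrthonormalBasis (Fin n) ℂ E) (s : Fin n → ℝ) : E →ₗ[ℂ] E :=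
  ∑ i, (innerSL ℂ (u i)).toLinearMap.smulRight ((s i : ℂ) • u i)

lemma inner_diagOp (u : OrthonormalBasis (Fin n) ℂ E) (s : Fin n → ℝ) (x : E) (i : Fin n) :
    ⟪u i, diagOp u s x⟫_ℂ = s i * ⟪u i, x⟫_ℂ := by
  simp [diagOp, orthonormal_iff_ite.1 u.orthonormal, mul_comm]

lemma diagOp_isSymmetric (u : OrthonormalBasis (Fin n) ℂ E) (s : Fin n → ℝ) :
    (diagOp u s).IsSymmetric := by
  intro x y
  rw [← u.sum_inner_mul_inner, ← u.sum_inner_mul_inner]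
  refine Finset.sum_congr rfl fun i _ => ?_
  rw [← inner_conj_symm (diagOp u s x), inner_diagOp, inner_diagOp]
  simp
  ring

lemma inner_self_diagOp (u : OrthonormalBasis (Fin n) ℂ E) (s : Fin n → ℝ) (x : E) :
    ⟪x, diagOp u s x⟫_ℂ = (diagForm u s x : ℂ) := by
  rw [← u.sum_inner_mul_inner, diagForm]
  push_cast
  refine Finset.sum_congr rfl fun i _ => ?_
  rw [inner_diagOp, ← inner_conj_symm x, ← Complex.conj_mul']
  ring

lemma norm_sq_diagOp (u : OrthonormalBasis (Fin n) ℂ E) (s : Fin n → ℝ) (x : E) :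
    ‖diagOp u s x‖ ^ 2 = diagForm u (fun i => s i ^ 2) x := by
  rw [← u.sum_sq_norm_inner_right, diagForm]
  refine Finset.sum_congr rfl fun i _ => ?_
  rw [inner_diagOp, norm_mul, mul_pow]
  simp

lemma diagOp_apply_self (u : OrthonormalBasis (Fin n) ℂ E) (s : Fin n → ℝ) (j : Fin n) :
    diagOp u s (u j) = (s j : ℂ) • u j := by
  simp [diagOp, orthonormal_iff_ite.1 u.orthonormal]

lemma eq_diagOp {u : OrthonormalBasis (Fin n) ℂ E} {s : Fin n → ℝ} {T : E →ₗ[ℂ] E}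
    (h : ∀ j, T (u j) = (s j : ℂ) • u j) : T = diagOp u s :=
  u.toBasis.ext fun j => by simpa [diagOp_apply_self] using h j

lemma diagForm_apply_self (u : OrthonormalBasis (Fin n) ℂ E) (s : Fin n → ℝ) (j : Fin n) :
    diagForm u s (u j) = s j := by
  simp [diagForm, orthonormal_iff_ite.1 u.orthonormal, apply_ite]

lemma diagForm_nonneg (u : OrthonormalBasis (Fin n) ℂ E) {s : Fin n → ℝ} (hs : ∀ i, 0 ≤ s i)
    (x : E) : 0 ≤ diagForm u s x :=
  Finset.sum_nonneg fun i _ => mul_nonneg (hs i) (sq_nonneg _)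

lemma diagForm_const_add (u : OrthonormalBasis (Fin n) ℂ E) (c : ℝ) (s : Fin n → ℝ) (x : E) :
    diagForm u (fun i => c + s i) x = c * ‖x‖ ^ 2 + diagForm u s x := by
  simp only [diagForm, add_mul, Finset.sum_add_distrib, ← Finset.mul_sum,
    u.sum_sq_norm_inner_right]

/-- The trace does not depend on the orthonormal basis. -/
lemma sum_diagForm (u v : OrthonormalBasis (Fin n) ℂ E) (s : Fin n → ℝ) :
    ∑ j, diagForm u s (v j) = ∑ i, s i := by
  simp only [diagForm]
  rw [Finset.sum_comm]
  simp only [← Finset.mul_sum, v.sum_sq_norm_inner_left]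
  simp

/-- Ky Fan's maximum principle. -/
lemma partialSum_diagForm_le (u v : OrthonormalBasis (Fin n) ℂ E) {s : Fin n → ℝ}
    (hs : Antitone s) {k : ℕ} (hk : k ≤ n) :
    partialSum (fun j => diagForm u s (v j)) k ≤ partialSum s k := by
  have h : partialSum (fun j => diagForm u s (v j)) k
      = ∑ i, s i * ∑ j : Fin n with j.val < k, ‖⟪u i, v j⟫_ℂ‖ ^ 2 := by
    simp only [partialSum, diagForm]
    rw [Finset.sum_comm]
    simp only [Finset.mul_sum]
  rw [h]
  refine sum_mul_le_partialSum hk hs (fun i => by positivity) (fun i => ?_) ?_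
  · calc _ ≤ ∑ j, ‖⟪u i, v j⟫_ℂ‖ ^ 2 :=
          Finset.sum_le_sum_of_subset_of_nonneg (Finset.subset_univ _) fun _ _ _ => sq_nonneg _
      _ = 1 := by rw [v.sum_sq_norm_inner_left]; simp
  · rw [Finset.sum_comm]
    simp [u.sum_sq_norm_inner_right, Fin.card_filter_val_lt, hk]

/-- Weyl's monotonicity principle. -/
lemma le_of_diagForm_le {u v : OrthonormalBasis (Fin n) ℂ E} {s t : Fin n → ℝ}
    (hs : Antitone s) (ht : Antitone t) (h : ∀ x, diagForm u s x ≤ diagForm v t x) (j : Fin n) :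
    s j ≤ t j := by
  have : FiniteDimensional ℂ E := u.toBasis.finiteDimensional_of_finite
  -- These are `n - 1` linear conditions, so some nonzero `x` lies in the span of the `u i` with `i
  -- ≤ j` and in that of the `v i` with `i ≥ j`.
  let φ : E →ₗ[ℂ] ({i : Fin n // i ≠ j} → ℂ) :=
    LinearMap.pi fun i => (innerSL ℂ (if i.1 < j then v i.1 else u i.1)).toLinearMap
  have hdim : Module.finrank ℂ ({i : Fin n // i ≠ j} → ℂ) < Module.finrank ℂ E := by
    have hE : Module.finrank ℂ E = n := by
      simpa using Module.finrank_eq_card_basis u.toBasis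
    have := j.2
    simp [hE]
    omega
  obtain ⟨x, hx, hx0⟩ := Submodule.exists_mem_ne_zero_of_ne_bot
    (LinearMap.ker_ne_bot_of_finrank_lt (f := φ) hdim)
  have hφ : ∀ i, i ≠ j → ⟪(if i < j then v i else u i), x⟫_ℂ = 0 := fun i hi =>
    congrFun (LinearMap.mem_ker.1 hx) ⟨i, hi⟩
  have h1 : s j * ‖x‖ ^ 2 ≤ diagForm u s x := by
    rw [← u.sum_sq_norm_inner_right, Finset.mul_sum]
    refine Finset.sum_le_sum fun i _ => ?_
    rcases le_or_gt i j with hij | hij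
    · exact mul_le_mul_of_nonneg_right (hs hij) (sq_nonneg _)
    · have := hφ i hij.ne'
      rw [if_neg hij.not_gt] at this
      simp [this]
  have h2 : diagForm v t x ≤ t j * ‖x‖ ^ 2 := by
    rw [← v.sum_sq_norm_inner_right, Finset.mul_sum]
    refine Finset.sum_le_sum fun i _ => ?_
    rcases lt_or_ge i j with hij | hij
    · have := hφ i hij.ne
      rw [if_pos hij] at this
      simp [this]
    · exact mul_le_mul_of_nonneg_right (ht hij) (sq_nonneg _)
  have hx' : 0 < ‖x‖ ^ 2 := by positivity
  exact le_of_mul_le_mul_right (h1.trans ((h x).trans h2)) hx'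

/-- A consequence of von Neumann's trace inequality: for an antitone function `g` and operators
`A ≤ W`, the trace of `W g(W)` is at most the trace of `W g(A)`. -/
lemma sum_mul_le_sum_mul_diagForm {a w : OrthonormalBasis (Fin n) ℂ E} {α ω : Fin n → ℝ}
    (hα : Antitone α) (hω : Antitone ω) (h : ∀ x, diagForm a α x ≤ diagForm w ω x)
    (hω0 : ∀ j, 0 ≤ ω j) {g : ℝ → ℝ} (hg : Antitone g) :
    ∑ j, g (ω j) * ω j ≤ ∑ j, g (α j) * diagForm w ω (a j) :=
  calc ∑ j, g (ω j) * ω j ≤ ∑ j, g (α j) * ω j :=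
        Finset.sum_le_sum fun j _ =>
          mul_le_mul_of_nonneg_right (hg (le_of_diagForm_le hα hω h j)) (hω0 j)
    _ ≤ ∑ j, g (α j) * diagForm w ω (a j) :=
        sum_mul_le_sum_mul_of_monotone (fun _ _ hij => hg (hα hij))
          (fun _ hk => partialSum_diagForm_le w a hω hk) (sum_diagForm w a ω)

lemma exists_eq_diagOp {T : E →ₗ[ℂ] E} (hT : T.IsSymmetric)
    (u : OrthonormalBasis (Fin n) ℂ E) :
    ∃ (w : OrthonormalBasis (Fin n) ℂ E) (x : Fin n → ℝ), Antitone x ∧ T = diagOp w x := by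
  have : FiniteDimensional ℂ E := u.toBasis.finiteDimensional_of_finite
  have hE : Module.finrank ℂ E = n := by
    simpa using Module.finrank_eq_card_basis u.toBasis
  exact ⟨hT.eigenvectorBasis hE, hT.eigenvalues hE, hT.eigenvalues_antitone hE,
    eq_diagOp fun j => hT.apply_eigenvectorBasis hE j⟩

end Form

/-! ### Concave functions on the half-line. -/

section Concave

variable {f : ℝ → ℝ}

lemma mul_le_apply_mul (hf : ConcaveOn ℝ (Set.Ici 0) f) (hf0 : f 0 = 0) {θ y : ℝ}
    (h0 : 0 ≤ θ) (h1 : θ ≤ 1) (hy : 0 ≤ y) : θ * f y ≤ f (θ * y) := by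
  have := hf.2 (Set.mem_Ici.2 hy) (Set.mem_Ici.2 le_rfl) h0 (sub_nonneg.2 h1) (by ring)
  simpa [hf0] using this

lemma div_le_div_of_concave (hf : ConcaveOn ℝ (Set.Ici 0) f) (hf0 : f 0 = 0) {x y : ℝ}
    (hx : 0 < x) (hxy : x ≤ y) : f y / y ≤ f x / x := by
  have hy := hx.trans_le hxy
  have := mul_le_apply_mul hf hf0 (div_nonneg hx.le hy.le) ((div_le_one hy).2 hxy) hy.le
  rw [div_mul_cancel₀ _ hy.ne'] at this
  rw [le_div_iff₀ hx]
  calc f y / y * x = x / y * f y := by ring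
    _ ≤ f x := this

lemma monotoneOn_of_concave_of_nonneg (hf : ConcaveOn ℝ (Set.Ici 0) f)
    (hfn : ∀ x, 0 ≤ x → 0 ≤ f x) : MonotoneOn f (Set.Ici 0) := by
  intro x hx y hy hxy
  by_contra! hlt
  have hx : 0 ≤ x := hx
  have hne : x < y := lt_of_le_of_ne hxy fun h => by simp [h] at hlt
  -- The chord from `x` to `y`, prolonged to `z`, has height `-(f x - f y) < 0`, and concavity keeps
  -- `f z` below it.
  set z := y + (f y / (f x - f y) + 1) * (y - x)
  have hfy := hfn y hy
  have hd : 0 < f x - f y := sub_pos.2 hlt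
  have hyx : 0 < y - x := sub_pos.2 hne
  have hq : 0 ≤ f y / (f x - f y) := by positivity
  have hyz : y < z := by
    have : 0 < (f y / (f x - f y) + 1) * (y - x) := by positivity
    simp only [z]; linarith
  have hz := hfn z (by linarith)
  have hs := hf.slope_anti_adjacent (Set.mem_Ici.2 hx)
    (Set.mem_Ici.2 (by linarith : (0 : ℝ) ≤ z)) hne hyz
  rw [div_le_div_iff₀ (by linarith) hyx] at hs
  have hzy : z - y = (f y / (f x - f y) + 1) * (y - x) := by simp [z]
  rw [hzy] at hs
  have hcancel : f y / (f x - f y) * (f x - f y) = f y := div_mul_cancel₀ _ hd.ne'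
  have : f z - f y ≤ (f y - f x) * (f y / (f x - f y) + 1) :=
    le_of_mul_le_mul_right (by linarith) hyx
  nlinarith

/-- Jensen's inequality for weights of total mass at most one. -/
lemma sum_mul_le_apply_sum {ι : Type*} {s : Finset ι} {l : ℝ} (hl : 0 ≤ l)
    (hf : ConcaveOn ℝ (Set.Ici 0) f) {π t : ι → ℝ} (hπ : ∀ i ∈ s, 0 ≤ π i)
    (hπ1 : ∑ i ∈ s, π i ≤ 1) (ht : ∀ i ∈ s, l ≤ t i) :
    ∑ i ∈ s, π i * (f (t i) - f l) ≤ f (l + ∑ i ∈ s, π i * (t i - l)) - f l := by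
  have := hf.map_add_sum_le (v := 1 - ∑ i ∈ s, π i) (w := π) (p := t) (q := l) (t := s) hπ
    (by ring) (fun i hi => Set.mem_Ici.2 (hl.trans (ht i hi))) (by linarith) (Set.mem_Ici.2 hl)
  simp only [smul_eq_mul] at this
  have h1 : l + ∑ i ∈ s, π i * (t i - l) = (1 - ∑ i ∈ s, π i) * l + ∑ i ∈ s, π i * t i := by
    simp only [mul_sub, Finset.sum_sub_distrib, ← Finset.sum_mul]; ring
  rw [h1]
  simp only [mul_sub, Finset.sum_sub_distrib, ← Finset.sum_mul]
  linarith

end Concave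

/-! ### The trace inequality for `0 ≤ A ≤ S`. -/

section Form

variable {E : Type*} [NormedAddCommGroup E] [InnerProductSpace ℂ E] {n : ℕ}

/-- The square root of the operator with quadratic form `diagForm a α`. -/
noncomputable def sqrtOp (a : OrthonormalBasis (Fin n) ℂ E) (α : Fin n → ℝ) : E →ₗ[ℂ] E :=
  diagOp a fun j => √(α j)

lemma norm_sq_sqrtOp (a : OrthonormalBasis (Fin n) ℂ E) {α : Fin n → ℝ} (hα : ∀ j, 0 ≤ α j)
    (x : E) : ‖sqrtOp a α x‖ ^ 2 = diagForm a α x := by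
  simp [sqrtOp, norm_sq_diagOp, Real.sq_sqrt (hα _)]

lemma sqrtOp_isSymmetric (a : OrthonormalBasis (Fin n) ℂ E) (α : Fin n → ℝ) :
    (sqrtOp a α).IsSymmetric :=
  diagOp_isSymmetric a _

lemma norm_sq_inner_sqrtOp_apply_self (a : OrthonormalBasis (Fin n) ℂ E) {α : Fin n → ℝ}
    (hα : ∀ j, 0 ≤ α j) (j : Fin n) (x : E) :
    ‖⟪x, sqrtOp a α (a j)⟫_ℂ‖ ^ 2 = α j * ‖⟪x, a j⟫_ℂ‖ ^ 2 := by
  rw [sqrtOp, diagOp_apply_self, inner_smul_right, norm_mul, mul_pow]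
  simp [Real.sq_sqrt (hα j)]

/-- If `A ≤ S` then `√A h(S) √A ≤ l` whenever `0 ≤ h` and `t h(t) ≤ l` on the spectrum of `S`. -/
lemma diagForm_sqrtOp_le {u a : OrthonormalBasis (Fin n) ℂ E} {s α η : Fin n → ℝ}
    (hα : ∀ j, 0 ≤ α j) (hle : ∀ x, diagForm a α x ≤ diagForm u s x) (hη : ∀ i, 0 ≤ η i)
    {l : ℝ} (hl : 0 ≤ l) (hsη : ∀ i, s i * η i ≤ l) (y : E) :
    diagForm u η (sqrtOp a α y) ≤ l * ‖y‖ ^ 2 := by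
  set z := sqrtOp a α y
  -- Since `‖√A h‖² = ⟨h, A h⟩ ≤ ⟨h, S h⟩ ≤ l G`, Cauchy–Schwarz on `G = ⟨y, √A h⟩` gives `G² ≤ l
  -- ‖y‖² G`; no inverse of `S` is needed.
  set h := diagOp u η z
  set G := diagForm u η z
  have hG0 : 0 ≤ G := diagForm_nonneg u hη z
  have h1 : ⟪y, sqrtOp a α h⟫_ℂ = (G : ℂ) := by
    rw [← inner_self_diagOp, ← sqrtOp_isSymmetric a α y h]
  have h2 : G ≤ ‖y‖ * ‖sqrtOp a α h‖ := by
    have := norm_inner_le_norm (𝕜 := ℂ) y (sqrtOp a α h)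
    rwa [h1, Complex.norm_real, Real.norm_of_nonneg hG0] at this
  have h3 : ‖sqrtOp a α h‖ ^ 2 ≤ l * G := by
    rw [norm_sq_sqrtOp a hα]
    refine (hle h).trans ?_
    simp only [diagForm, G, h, Finset.mul_sum]
    refine Finset.sum_le_sum fun i _ => ?_
    rw [inner_diagOp, norm_mul, mul_pow, Complex.norm_real, Real.norm_of_nonneg (hη i)]
    have := mul_le_mul_of_nonneg_right (hsη i)
      (mul_nonneg (hη i) (sq_nonneg ‖⟪u i, z⟫_ℂ‖))
    linarith
  have h4 : G * G ≤ (l * ‖y‖ ^ 2) * G := by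
    calc G * G ≤ (‖y‖ * ‖sqrtOp a α h‖) * (‖y‖ * ‖sqrtOp a α h‖) :=
          mul_self_le_mul_self hG0 h2
      _ = ‖y‖ ^ 2 * ‖sqrtOp a α h‖ ^ 2 := by ring
      _ ≤ ‖y‖ ^ 2 * (l * G) := mul_le_mul_of_nonneg_left h3 (sq_nonneg _)
      _ = (l * ‖y‖ ^ 2) * G := by ring
  rcases hG0.eq_or_lt with h0 | hpos
  · rw [← h0]; positivity
  · exact le_of_mul_le_mul_right h4 hpos

/-- If `0 ≤ A ≤ S`, then the trace of `f(A)` on the span of the eigenvectors of the `k` largest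
eigenvalues of `S` is at least that of `S^{-1/2} A S^{-1/2} f(S)`. -/
lemma sum_div_mul_diagForm_le {u a : OrthonormalBasis (Fin n) ℂ E} {s α : Fin n → ℝ}
    (hs : Antitone s) (hα : Antitone α) (hα0 : ∀ j, 0 ≤ α j)
    (hle : ∀ x, diagForm a α x ≤ diagForm u s x) {f : ℝ → ℝ}
    (hf : ConcaveOn ℝ (Set.Ici 0) f) (hf0 : f 0 = 0) (m : Fin n) (hm : 0 < s m) :
    ∑ i with i ≤ m, f (s i) / s i * diagForm a α (u i)
      ≤ ∑ i with i ≤ m, diagForm a (fun j => f (α j)) (u i) := by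
  set l := s m
  set P : Finset (Fin n) := {i | i ≤ m}
  have hPl : ∀ i ∈ P, l ≤ s i := fun i hi => hs (by simpa [P] using hi)
  have hPpos : ∀ i ∈ P, 0 < s i := fun i hi => hm.trans_le (hPl i hi)
  set r := sqrtOp a α
  -- This is `(1 - l/s)₊`; the `max` avoids dividing by eigenvalues that vanish.
  set θ : Fin n → ℝ := fun i => 1 - l / max (s i) l
  have hmax : ∀ i, 0 < max (s i) l := fun i => lt_max_of_lt_right hm
  have hθ : ∀ i, 0 ≤ θ i := fun i => sub_nonneg.2 ((div_le_one (hmax i)).2 (le_max_right _ _))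
  have hθP : ∀ i ∈ P, θ i = (s i - l) / s i := fun i hi => by
    simp only [θ, max_eq_left (hPl i hi), sub_div, div_self (hPpos i hi).ne']
  have hθnP : ∀ i, i ∉ P → θ i = 0 := fun i hi => by
    have : s i ≤ l := hs (by simp [P] at hi; exact hi.le)
    simp [θ, max_eq_right this, div_self hm.ne']
  -- the bounds obtained from `A ≤ S`
  have hη : ∀ y, diagForm u (fun i => 1 - θ i) (r y) ≤ l * ‖y‖ ^ 2 :=
    diagForm_sqrtOp_le hα0 hle (fun i => by
        simp only [θ, sub_sub_cancel]; have := hmax i; positivity) hm.le (fun i => by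
        simp only [θ, sub_sub_cancel]
        rw [mul_div_assoc', div_le_iff₀ (hmax i), mul_comm]
        exact mul_le_mul_of_nonneg_left (le_max_left _ _) hm.le)
  have hweight : ∀ y, ∑ i ∈ P, (s i)⁻¹ * ‖⟪u i, r y⟫_ℂ‖ ^ 2 ≤ ‖y‖ ^ 2 := by
    intro y
    refine le_of_mul_le_mul_left (le_trans ?_ (hη y)) hm
    rw [Finset.mul_sum, diagForm]
    refine (Finset.sum_le_sum fun i hi => ?_).trans (Finset.sum_le_sum_of_subset_of_nonneg
      (Finset.subset_univ P) fun i _ _ => mul_nonneg ?_ (sq_nonneg _))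
    · rw [hθP i hi, ← mul_assoc]
      refine mul_le_mul_of_nonneg_right (le_of_eq ?_) (sq_nonneg _)
      have := (hPpos i hi).ne'
      field_simp
      ring
    · simp only [θ, sub_sub_cancel]; have := hmax i; positivity
  -- the operator `√A θ(S) √A` and its eigenbasis
  obtain ⟨w, x, hx, hX⟩ := exists_eq_diagOp (T := r ∘ₗ diagOp u θ ∘ₗ r) (fun y z => by
    simp only [LinearMap.comp_apply]
    rw [sqrtOp_isSymmetric a α _ z, diagOp_isSymmetric u θ, sqrtOp_isSymmetric a α y]) u
  have hform : ∀ y, diagForm w x y = diagForm u θ (r y) := by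
    intro y
    have h1 := inner_self_diagOp w x y
    rw [← hX, LinearMap.comp_apply, LinearMap.comp_apply, ← sqrtOp_isSymmetric a α y] at h1
    exact_mod_cast h1.symm.trans (inner_self_diagOp u θ (r y))
  have hformP : ∀ y, diagForm w x y
      = ∑ i ∈ P, ((s i)⁻¹ * ‖⟪u i, r y⟫_ℂ‖ ^ 2) * (s i - l) := by
    intro y
    rw [hform, diagForm, ← Finset.sum_subset (Finset.subset_univ P)
      (fun i _ hi => by rw [hθnP i hi, zero_mul])]
    refine Finset.sum_congr rfl fun i hi => ?_
    rw [hθP i hi]; ring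
  have hx0 : ∀ j, 0 ≤ x j := fun j => by
    rw [← diagForm_apply_self w x j, hform]; exact diagForm_nonneg u hθ _
  -- The eigenvalues of `W = l + √A θ(S) √A`. Here `W - A = l - √A (1 - θ(S)) √A`, which is
  -- nonnegative by `hη`.
  set ω : Fin n → ℝ := fun j => l + x j
  have hω : Antitone ω := fun i j hij => add_le_add_right (hx hij) l
  have hωl : ∀ j, l ≤ ω j := fun j => by simp only [ω]; linarith [hx0 j]
  have hAW : ∀ y, diagForm a α y ≤ diagForm w ω y := by
    intro y
    rw [diagForm_const_add, hform, ← norm_sq_sqrtOp a hα0, ← u.sum_sq_norm_inner_right]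
    have := hη y
    simp only [diagForm, sub_mul, one_mul, Finset.sum_sub_distrib] at this ⊢
    linarith
  -- the truncated slope function
  set g : ℝ → ℝ := fun t => f (max t l) / max t l
  have hg : Antitone g := fun x y hxy =>
    div_le_div_of_concave hf hf0 (lt_max_of_lt_right hm) (max_le_max_right _ hxy)
  have hgl : ∀ t, g t * l ≤ f l := fun t => by
    rw [← le_div_iff₀ hm]
    exact div_le_div_of_concave hf hf0 hm (le_max_right _ _)
  have hgf : ∀ t, 0 ≤ t → g t * t ≤ f t := fun t ht => by
    rcases ht.eq_or_lt with rfl | ht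
    · simp [hf0]
    · rw [← le_div_iff₀ ht]
      exact div_le_div_of_concave hf hf0 ht (le_max_left _ _)
  have hgω : ∀ j, g (ω j) * ω j = f (ω j) := fun j => by
    simp only [g, max_eq_left (hωl j)]
    exact div_mul_cancel₀ _ (hm.trans_le (hωl j)).ne'
  -- The diagonal of `√A S⁻¹ √A`, with `S⁻¹` cut down to the indices in `P`, in the eigenbasis of
  -- `A`.
  set ρ : Fin n → ℝ := fun j => ∑ i ∈ P, (s i)⁻¹ * ‖⟪u i, r (a j)⟫_ℂ‖ ^ 2
  have hρ1 : ∀ j, ρ j ≤ 1 := fun j => by simpa using hweight (a j)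
  have htrace : ∀ v : OrthonormalBasis (Fin n) ℂ E, ∀ i,
      ∑ j, ‖⟪u i, r (v j)⟫_ℂ‖ ^ 2 = diagForm a α (u i) := fun v i => by
    rw [← norm_sq_sqrtOp a hα0, ← v.sum_sq_norm_inner_left]
    exact Finset.sum_congr rfl fun j _ => by rw [sqrtOp_isSymmetric a α (u i)]
  have hρ : ∑ j, ρ j = ∑ i ∈ P, (s i)⁻¹ * diagForm a α (u i) := by
    simp only [ρ]
    rw [Finset.sum_comm]
    simp only [← Finset.mul_sum, htrace]
  -- the lower bound by the trace of `f(W)`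
  have hlower : ∑ j, f (ω j) - f l * ∑ j, (1 - ρ j)
      ≤ ∑ i ∈ P, diagForm a (fun j => f (α j)) (u i) := by
    have hswap : ∑ i ∈ P, diagForm a (fun j => f (α j)) (u i)
        = ∑ j, f (α j) * ∑ i ∈ P, ‖⟪u i, a j⟫_ℂ‖ ^ 2 := by
      simp only [diagForm]
      rw [Finset.sum_comm]
      refine Finset.sum_congr rfl fun j _ => ?_
      rw [Finset.mul_sum]
      exact Finset.sum_congr rfl fun i _ => by rw [norm_inner_symm]
    have hW : ∀ j, diagForm w ω (a j)
        = α j * (∑ i ∈ P, ‖⟪u i, a j⟫_ℂ‖ ^ 2) + l * (1 - ρ j) := by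
      intro j
      have h1 : ∑ i ∈ P, ((s i)⁻¹ * ‖⟪u i, r (a j)⟫_ℂ‖ ^ 2) * (s i - l)
          = ∑ i ∈ P, ‖⟪u i, r (a j)⟫_ℂ‖ ^ 2 - l * ρ j := by
        simp only [ρ, Finset.mul_sum, ← Finset.sum_sub_distrib]
        refine Finset.sum_congr rfl fun i hi => ?_
        have := (hPpos i hi).ne'
        field_simp
      have h2 : ∑ i ∈ P, ‖⟪u i, r (a j)⟫_ℂ‖ ^ 2 = α j * ∑ i ∈ P, ‖⟪u i, a j⟫_ℂ‖ ^ 2 := by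
        rw [Finset.mul_sum]
        exact Finset.sum_congr rfl fun i _ => norm_sq_inner_sqrtOp_apply_self a hα0 j (u i)
      rw [diagForm_const_add, hformP, h1, h2, a.orthonormal.1 j]
      ring
    have hvN := sum_mul_le_sum_mul_diagForm hα hω hAW (fun j => hm.le.trans (hωl j)) hg
    simp only [hgω] at hvN
    rw [hswap, Finset.mul_sum, sub_le_iff_le_add, ← Finset.sum_add_distrib]
    refine hvN.trans (Finset.sum_le_sum fun j _ => ?_)
    rw [hW, mul_add]
    refine add_le_add ?_ ?_
    · rw [← mul_assoc]
      exact mul_le_mul_of_nonneg_right (hgf _ (hα0 j)) (by positivity)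
    · rw [← mul_assoc]
      exact mul_le_mul_of_nonneg_right (hgl _) (sub_nonneg.2 (hρ1 j))
  -- Jensen's inequality for the trace of `f(W)`
  have hjensen : ∑ i ∈ P, (s i)⁻¹ * diagForm a α (u i) * (f (s i) - f l)
      ≤ ∑ j, (f (ω j) - f l) := by
    -- By `hformP`, `ω j - l` is a combination of the `s i - l` with these weights, of total mass at
    -- most one by `hweight`.
    have h1 : ∀ j, ∑ i ∈ P, ((s i)⁻¹ * ‖⟪u i, r (w j)⟫_ℂ‖ ^ 2) * (f (s i) - f l)
        ≤ f (ω j) - f l := by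
      intro j
      have := sum_mul_le_apply_sum (s := P) hm.le hf
        (π := fun i => (s i)⁻¹ * ‖⟪u i, r (w j)⟫_ℂ‖ ^ 2) (t := s)
        (fun i hi => by have := hPpos i hi; positivity)
        (by simpa using hweight (w j)) hPl
      rwa [← hformP, diagForm_apply_self] at this
    refine le_trans (le_of_eq ?_) (Finset.sum_le_sum fun j _ => h1 j)
    rw [Finset.sum_comm]
    simp only [← Finset.sum_mul, ← Finset.mul_sum, htrace]
  refine le_trans (le_of_eq ?_) (le_trans (add_le_add_left hjensen
    (f l * ∑ j, ρ j)) (le_trans (le_of_eq ?_) hlower))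
  · rw [hρ, Finset.mul_sum, ← Finset.sum_add_distrib]
    exact Finset.sum_congr rfl fun i _ => by ring
  · simp only [Finset.sum_sub_distrib, mul_sub, Finset.mul_sum, mul_one]
    ring

/-- If `S = A + B` with `A` and `B` positive, then the trace of `f(S)` on the span of the
eigenvectors of the `k` largest eigenvalues of `S` is at most that of `f(A) + f(B)`. -/
lemma partialSum_apply_le {u a b : OrthonormalBasis (Fin n) ℂ E} {s α β : Fin n → ℝ}
    (hs : Antitone s) (hα : Antitone α) (hβ : Antitone β) (hα0 : ∀ j, 0 ≤ α j)
    (hβ0 : ∀ j, 0 ≤ β j) (hsum : ∀ x, diagForm u s x = diagForm a α x + diagForm b β x)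
    {f : ℝ → ℝ} (hfn : ∀ x, 0 ≤ x → 0 ≤ f x) (hf : ConcaveOn ℝ (Set.Ici 0) f) (hf0 : f 0 = 0)
    {k : ℕ} (hk : k ≤ n) :
    partialSum (fun i => f (s i)) k ≤ partialSum (fun i =>
      diagForm a (fun j => f (α j)) (u i) + diagForm b (fun j => f (β j)) (u i)) k := by
  have hs0 : ∀ i, 0 ≤ s i := fun i => by
    rw [← diagForm_apply_self u s i, hsum]
    exact add_nonneg (diagForm_nonneg a hα0 _) (diagForm_nonneg b hβ0 _)
  induction k with
  | zero => simp [partialSum]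
  | succ k ih =>
    set m : Fin n := ⟨k, hk⟩
    have hfilter : (Finset.univ.filter fun j : Fin n => j.val < k + 1)
        = Finset.univ.filter fun j : Fin n => j ≤ m := by
      ext j; simp [m, Fin.le_def]
    -- If `s m = 0`, there is no `f(s)/s` to form, but index `m` adds `f 0 = 0` on the left and a
    -- nonnegative term on the right. Only this case uses the induction hypothesis.
    rcases (hs0 m).eq_or_lt with hm | hm
    · have hset : (Finset.univ.filter fun j : Fin n => j.val < k + 1)
          = insert m (Finset.univ.filter fun j : Fin n => j.val < k) := by
        ext j; simp [m, Fin.ext_iff]; omega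
      have ih' := ih (by omega)
      unfold partialSum at ih' ⊢
      rw [hset, Finset.sum_insert (by simp [m]), Finset.sum_insert (by simp [m]), ← hm, hf0]
      exact add_le_add (add_nonneg (diagForm_nonneg a (fun j => hfn _ (hα0 j)) _)
        (diagForm_nonneg b (fun j => hfn _ (hβ0 j)) _)) ih'
    · unfold partialSum
      rw [hfilter, Finset.sum_add_distrib]
      refine le_trans (le_of_eq ?_) (add_le_add
        (sum_div_mul_diagForm_le (u := u) hs hα hα0 (fun x => by
          rw [hsum]; linarith [diagForm_nonneg b hβ0 x]) hf hf0 m hm)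
        (sum_div_mul_diagForm_le (u := u) hs hβ hβ0 (fun x => by
          rw [hsum]; linarith [diagForm_nonneg a hα0 x]) hf hf0 m hm))
      rw [← Finset.sum_add_distrib]
      refine Finset.sum_congr rfl fun i hi => ?_
      have hpos : 0 < s i := hm.trans_le (hs (by simpa using hi))
      rw [← mul_add, ← hsum, diagForm_apply_self, div_mul_cancel₀ _ hpos.ne']

end Form

/-! ### Transfer to matrices, and one-sided derivatives of Ky Fan sums. -/

section Matrix

variable {n : ℕ}

/-- The quadratic form of a complex matrix. -/
noncomputable def matForm (M : Matrix (Fin n) (Fin n) ℂ) (x : EuclideanSpace ℂ (Fin n)) : ℝ :=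
  (⟪x, Matrix.toEuclideanLin M x⟫_ℂ).re

lemma matForm_add (M N : Matrix (Fin n) (Fin n) ℂ) (x : EuclideanSpace ℂ (Fin n)) :
    matForm (M + N) x = matForm M x + matForm N x := by
  simp [matForm]

lemma matForm_smul (t : ℝ) (M : Matrix (Fin n) (Fin n) ℂ) (x : EuclideanSpace ℂ (Fin n)) :
    matForm (t • M) x = t * matForm M x := by
  have : t • M = (t : ℂ) • M := by ext; simp
  rw [matForm, this, map_smul, LinearMap.smul_apply, inner_smul_right, Complex.re_ofReal_mul,
    matForm]

/-- A reordering of Mathlib's eigenvector basis that matches the order of `eigs`. -/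
noncomputable def eigBasis {M : Matrix (Fin n) (Fin n) ℂ} (hM : M.IsHermitian) :
    OrthonormalBasis (Fin n) ℂ (EuclideanSpace ℂ (Fin n)) :=
  hM.eigenvectorBasis.reindex
    ((finCongr (Fintype.card_fin n).symm).trans (Fintype.equivOfCardEq (Fintype.card_fin _))).symm

lemma cfc_eigBasis {M : Matrix (Fin n) (Fin n) ℂ} (hM : M.IsHermitian) (f : ℝ → ℝ) (j : Fin n) :
    Matrix.toEuclideanLin (cfc f M) (eigBasis hM j) = (f (eigs hM j) : ℂ) • eigBasis hM j := by
  have key : ∀ i, Matrix.toEuclideanLin (cfc f M) (hM.eigenvectorBasis i)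
      = (f (hM.eigenvalues i) : ℂ) • hM.eigenvectorBasis i := by
    intro i
    apply (WithLp.ofLp_injective 2)
    rw [Matrix.toLpLin_apply, hM.cfc_eq, Matrix.IsHermitian.cfc,
      Unitary.conjStarAlgAut_apply, ← Matrix.mulVec_mulVec, ← Matrix.mulVec_mulVec]
    rw [hM.star_eigenvectorUnitary_mulVec i]
    have hsingle : (Matrix.diagonal (RCLike.ofReal ∘ f ∘ hM.eigenvalues : Fin n → ℂ)).mulVec
        (Pi.single i 1) = (f (hM.eigenvalues i) : ℂ) • (Pi.single i 1 : Fin n → ℂ) := by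
      rw [Matrix.diagonal_mulVec_single, ← Pi.single_smul]
      simp
    rw [hsingle, Matrix.mulVec_smul, hM.eigenvectorUnitary_mulVec]
    rfl
  rw [eigBasis, OrthonormalBasis.reindex_apply, key]
  simp [Matrix.IsHermitian.eigenvalues, eigs]

lemma matForm_cfc {M : Matrix (Fin n) (Fin n) ℂ} (hM : M.IsHermitian) (f : ℝ → ℝ)
    (x : EuclideanSpace ℂ (Fin n)) :
    matForm (cfc f M) x = diagForm (eigBasis hM) (fun j => f (eigs hM j)) x := by
  rw [matForm, eq_diagOp (cfc_eigBasis hM f), inner_self_diagOp, Complex.ofReal_re]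

lemma matForm_eq_diagForm {M : Matrix (Fin n) (Fin n) ℂ} (hM : M.IsHermitian)
    (x : EuclideanSpace ℂ (Fin n)) : matForm M x = diagForm (eigBasis hM) (eigs hM) x := by
  have := matForm_cfc hM id x
  rwa [cfc_id ℝ M hM.isSelfAdjoint] at this

lemma partialSum_matForm_le {M : Matrix (Fin n) (Fin n) ℂ} (hM : M.IsHermitian)
    (v : OrthonormalBasis (Fin n) ℂ (EuclideanSpace ℂ (Fin n))) {k : ℕ} (hk : k ≤ n) :
    partialSum (fun j => matForm M (v j)) k ≤ partialSum (eigs hM) k := by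
  simp only [matForm_eq_diagForm hM]
  exact partialSum_diagForm_le _ v (eigs_antitone hM) hk

lemma partialSum_matForm_eigBasis {M : Matrix (Fin n) (Fin n) ℂ} (hM : M.IsHermitian) (k : ℕ) :
    partialSum (fun j => matForm M (eigBasis hM j)) k = partialSum (eigs hM) k := by
  simp only [matForm_eq_diagForm hM, diagForm_apply_self]

lemma partialSum_add_mul (a b : Fin n → ℝ) (t : ℝ) (k : ℕ) :
    partialSum (fun j => a j + t * b j) k = partialSum a k + t * partialSum b k := by
  simp only [partialSum, Finset.sum_add_distrib, Finset.mul_sum]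

lemma partialSum_matForm_add_smul (S Y : Matrix (Fin n) (Fin n) ℂ)
    (v : OrthonormalBasis (Fin n) ℂ (EuclideanSpace ℂ (Fin n))) (t : ℝ) (k : ℕ) :
    partialSum (fun j => matForm (S + t • Y) (v j)) k
      = partialSum (fun j => matForm S (v j)) k + t * partialSum (fun j => matForm Y (v j)) k := by
  simp only [matForm_add, matForm_smul, partialSum_add_mul]

variable {S Y : Matrix (Fin n) (Fin n) ℂ}

/-- By Ky Fan the path is a maximum, over orthonormal bases, of functions affine in `t`. Convexity
is what makes the one-sided derivatives exist. -/
lemma convexOn_kyFanPath (hY : Y.IsHermitian) (hS : S.IsHermitian) {k : ℕ} (hk : k ≤ n) :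
    ConvexOn ℝ Set.univ (kyFanPath hY hS k) := by
  refine ⟨convex_univ, fun x _ y _ p q hp hq hpq => ?_⟩
  set v := eigBasis (isHermitian_add_smul hY hS (p • x + q • y))
  have h0 : kyFanPath hY hS k (p • x + q • y) = _ :=
    (partialSum_matForm_eigBasis (isHermitian_add_smul hY hS (p • x + q • y)) k).symm
  have hx : _ ≤ kyFanPath hY hS k x :=
    partialSum_matForm_le (isHermitian_add_smul hY hS x) v hk
  have hy : _ ≤ kyFanPath hY hS k y :=
    partialSum_matForm_le (isHermitian_add_smul hY hS y) v hk
  rw [partialSum_matForm_add_smul] at h0 hx hy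
  rw [h0]
  refine le_trans (le_of_eq ?_)
    (add_le_add (mul_le_mul_of_nonneg_left hx hp) (mul_le_mul_of_nonneg_left hy hq))
  simp only [smul_eq_mul]
  linear_combination (-partialSum (fun j => matForm S (v j)) k) * hpq

lemma differentiableWithinAt_kyFanPath (hY : Y.IsHermitian) (hS : S.IsHermitian) {k : ℕ}
    (hk : k ≤ n) : DifferentiableWithinAt ℝ (kyFanPath hY hS k) (Set.Ici 0) 0 :=
  ((convexOn_kyFanPath hY hS hk).hasDerivWithinAt_rightDeriv_of_mem_interior
    (by simp)).Ici_of_Ioi.differentiableWithinAt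

lemma kyFanPath_zero (hY : Y.IsHermitian) (hS : S.IsHermitian) (k : ℕ) :
    kyFanPath hY hS k 0 = partialSum (eigs hS) k := by
  unfold kyFanPath
  congr 2
  simp

/-- The eigenbasis of `S` serves as a trial basis. As only a lower bound is wanted, it need not be
adapted to `Y` inside degenerate eigenspaces. -/
lemma le_kyFanPath (hY : Y.IsHermitian) (hS : S.IsHermitian) {k : ℕ} (hk : k ≤ n) (t : ℝ) :
    partialSum (eigs hS) k + t * partialSum (fun j => matForm Y (eigBasis hS j)) k
      ≤ kyFanPath hY hS k t := by
  have := partialSum_matForm_le (isHermitian_add_smul hY hS t) (eigBasis hS) hk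
  rwa [partialSum_matForm_add_smul, partialSum_matForm_eigBasis] at this

/-- `S + t f(S)` is diagonal in the eigenbasis of `S`, and its entries there are still in
non-increasing order, so Ky Fan's principle applies. -/
lemma kyFanPath_cfc_le (hS : S.IsHermitian) {f : ℝ → ℝ}
    (hf : Antitone fun j => f (eigs hS j)) {k : ℕ} (hk : k ≤ n) {t : ℝ} (ht : 0 ≤ t) :
    kyFanPath (isHermitian_cfc f S) hS k t
      ≤ partialSum (eigs hS) k + t * partialSum (fun j => f (eigs hS j)) k := by
  have h0 : kyFanPath (isHermitian_cfc f S) hS k t = _ :=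
    (partialSum_matForm_eigBasis (isHermitian_add_smul (isHermitian_cfc f S) hS t) k).symm
  rw [h0, partialSum_matForm_add_smul, ← partialSum_add_mul]
  rw [← partialSum_add_mul]
  refine le_trans (le_of_eq ?_) (partialSum_diagForm_le (eigBasis hS)
    (eigBasis (isHermitian_add_smul (isHermitian_cfc f S) hS t))
    (s := fun j => eigs hS j + t * f (eigs hS j)) (fun i j hij =>
      add_le_add (eigs_antitone hS hij) (mul_le_mul_of_nonneg_left (hf hij) ht)) hk)
  congr 1
  funext j
  rw [matForm_cfc hS, matForm_eq_diagForm hS]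
  simp only [diagForm, add_mul, Finset.sum_add_distrib, Finset.mul_sum, mul_assoc]

lemma derivWithin_Ici_le_of_le {F G : ℝ → ℝ} (hF : DifferentiableWithinAt ℝ F (Set.Ici 0) 0)
    (hG : DifferentiableWithinAt ℝ G (Set.Ici 0) 0) (h0 : F 0 = G 0)
    (h : ∀ t, 0 ≤ t → F t ≤ G t) :
    derivWithin F (Set.Ici 0) 0 ≤ derivWithin G (Set.Ici 0) 0 := by
  have h1 := hasDerivWithinAt_iff_tendsto_slope.1 hF.hasDerivWithinAt
  have h2 := hasDerivWithinAt_iff_tendsto_slope.1 hG.hasDerivWithinAt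
  rw [Set.Ici_sdiff_left] at h1 h2
  refine le_of_tendsto_of_tendsto h1 h2 ?_
  filter_upwards [self_mem_nhdsWithin] with t ht
  have ht : 0 < t := ht
  simp only [slope_def_field, h0]
  exact div_le_div_of_nonneg_right (by linarith [h t ht.le]) (by linarith)

lemma eigs_nonneg {A : Matrix (Fin n) (Fin n) ℂ} (hA : A.PosSemidef) (j : Fin n) :
    0 ≤ eigs hA.isHermitian j := by
  have := hA.eigenvalues_nonneg (Fintype.equivOfCardEq (Fintype.card_fin _)
    (Fin.cast (Fintype.card_fin n).symm j))
  simpa [Matrix.IsHermitian.eigenvalues, eigs] using this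

end Matrix

end DominatedMajorization

open DominatedMajorization in
theorem proposition4 (n : ℕ) (A B : Matrix (Fin n) (Fin n) ℂ)
    (hA : A.PosSemidef) (hB : B.PosSemidef)
    (f : ℝ → ℝ) (hf_nonneg : ∀ x : ℝ, 0 ≤ x → 0 ≤ f x)
    (hf_concave : ConcaveOn ℝ (Set.Ici 0) f) (hf_zero : f 0 = 0) :
    (∀ k : ℕ, k ≤ n →
      DifferentiableWithinAt ℝ
        (DominatedMajorization.kyFanPath
          (DominatedMajorization.isHermitian_cfc f (A + B)) (hA.add hB).isHermitian k)
        (Set.Ici 0) 0 ∧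
      DifferentiableWithinAt ℝ
        (DominatedMajorization.kyFanPath
          ((DominatedMajorization.isHermitian_cfc f A).add
            (DominatedMajorization.isHermitian_cfc f B)) (hA.add hB).isHermitian k)
        (Set.Ici 0) 0) ∧
    DominatedMajorization.WeakMajorized
      (DominatedMajorization.delta
        (DominatedMajorization.isHermitian_cfc f (A + B)) (hA.add hB).isHermitian)
      (DominatedMajorization.delta
        ((DominatedMajorization.isHermitian_cfc f A).add
          (DominatedMajorization.isHermitian_cfc f B)) (hA.add hB).isHermitian) := by
  have hS := (hA.add hB).isHermitian
  refine ⟨fun k hk => ⟨differentiableWithinAt_kyFanPath _ _ hk,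
    differentiableWithinAt_kyFanPath _ _ hk⟩, fun k _ hk => ?_⟩
  rw [partialSum_delta _ _ k hk, partialSum_delta _ _ k hk]
  refine derivWithin_Ici_le_of_le (differentiableWithinAt_kyFanPath _ _ hk)
    (differentiableWithinAt_kyFanPath _ _ hk) (by rw [kyFanPath_zero, kyFanPath_zero])
    fun t ht => ?_
  have hmono := monotoneOn_of_concave_of_nonneg hf_concave hf_nonneg
  refine (kyFanPath_cfc_le hS (fun i j hij => hmono (eigs_nonneg (hA.add hB) j)
    (eigs_nonneg (hA.add hB) i) (eigs_antitone hS hij)) hk ht).trans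
    (le_trans ?_ (le_kyFanPath _ hS hk t))
  refine add_le_add le_rfl (mul_le_mul_of_nonneg_left ?_ ht)
  simp only [matForm_add, matForm_cfc hA.isHermitian, matForm_cfc hB.isHermitian]
  exact partialSum_apply_le (eigs_antitone hS) (eigs_antitone hA.isHermitian)
    (eigs_antitone hB.isHermitian) (eigs_nonneg hA) (eigs_nonneg hB)
    (fun x => by
      rw [← matForm_eq_diagForm, ← matForm_eq_diagForm, ← matForm_eq_diagForm, matForm_add])
    hf_nonneg hf_concave hf_zero hk
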